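/- Let $Q_8=\{\pm1,\pm i,\pm j,\pm k\}$ be the quaternion group of order $8$ and $C_p$ the cyclic group of prime order $p\neq 3$. For a finite group $G$, let $\mathcal B(G)$ denote the Boolean algebra of subsets of $G$ generated by the normal subgroups of $G$ (the family of all sets obtained from normal subgroups by repeatedly taking unions, intersections and symmetric differences). For an inverse-closed subset $S\subseteq G$, let $\mathrm{Cayley}(G,S)$ be the graph with vertex set $G$ in which $x,y\in G$ are adjacent if and only if $xy^{-1}\in S$ (with a loop at every vertex if $1\in S$); it is called integral if all eigenvalues of its adjacency matrix are integers. Let $G=Q_8\times C_p$, let $S\subseteq G$ be an inverse-closed subset (not a multiset), and for $q\in Q_8$ put $B_q=\{a\in C_p : (q,a)\in S\}$. Then: 1. $\mathrm{Cayley}(G,S)$ is integral if and only if both of the following conditions hold: (P1) $B_1\in\mathcal B(C_p)$ and $B_{-1}\in\mathcal B(C_p)$; (P2) for every $q\in Q_8\setminus\{1,-1\}$, $B_q=B_{-q}\in\mathcal B(C_p)$. 2. $\mathrm{Cayley}(G,S)$ is integral if and only if $S\in\mathcal B(G)$. -/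

import Mathlib

/-- `x` and `y` are adjacent in the Cayley graph of `G` over `S`. A loop is present at every vertex
when `1 ∈ S`; for inverse-closed `S` the relation is symmetric. -/
def CayleyAdj {G : Type*} [Group G] (S : Set G) (x y : G) : Prop :=
  x * y⁻¹ ∈ S

open Classical in
/-- The adjacency matrix of the Cayley graph of `G` over `S`, with complex entries. -/
noncomputable def cayleyAdjMatrix {G : Type*} [Group G] (S : Set G) : Matrix G G ℂ :=
  Matrix.of fun x y => if CayleyAdj S x y then 1 else 0

open Classical in
/-- The Cayley graph of the finite group `G` over `S` is integral: all eigenvalues of its adjacency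
matrix are integers. -/
def CayleyIntegral {G : Type*} [Group G] [Fintype G] (S : Set G) : Prop :=
  ∀ μ : ℂ, Module.End.HasEigenvalue (Matrix.toLin' (cayleyAdjMatrix S)) μ → ∃ n : ℤ, μ = (n : ℂ)

/-- The Boolean algebra of subsets of `G` generated by the normal subgroups of `G`. -/
def normalBoolAlg (G : Type*) [Group G] : BooleanSubalgebra (Set G) :=
  BooleanSubalgebra.closure {T : Set G | ∃ N : Subgroup G, N.Normal ∧ T = (N : Set G)}

/-- The quaternion group of order `8`. -/
abbrev Q8 : Type := QuaternionGroup 2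

/-- The element `-1` of the quaternion group, its unique element of order two;
`-q` is `Q8.negOne * q`. -/
def Q8.negOne : Q8 := QuaternionGroup.a 2

/-- The cyclic group of order `p`, written multiplicatively. -/
abbrev Cyc (p : ℕ) : Type := Multiplicative (ZMod p)

/-- The fibre `B_q = {a ∈ A ∣ (q, a) ∈ S}` of a subset `S` of `Q₈ × A`. -/
def fibre {A : Type*} (S : Set (Q8 × A)) (q : Q8) : Set A :=
  {a : A | (q, a) ∈ S}

/-! The proof is a cycle: integral ⇒ (P1), (P2) ⇒ `S ∈ 𝓑(G)` ⇒ integral. The last step holds for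
every finite group: the indicator of `S` is an integer combination of indicators of normal
subgroups, whose convolution matrices commute and satisfy `T² = |N| T`. For the middle step, `S` is
a union of boxes `C × B_q` with `C = {1}, {-1}, {±q}`.

For the first, apply representations `ρ ⊗ χ` with `χ` a nontrivial character of `C_p`. The
2-dimensional `ρ` yields eigenvalues `x₀ ± √(-(x₁² + x₂² + x₃²))`, where the `xᵢ` are Fourier
coefficients of `1_{B_q} - 1_{B_{-q}}`; for `q ≠ ±1` these functions are odd. If the eigenvalues are
integers, `eq_zero_of_odd_of_sum_sq` forces the three odd functions to vanish for `p ≠ 3`, so `B_q =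
B_{-q}`. The sign characters then make every Fourier coefficient rational, and independence of the
powers of `ζ` puts each `B_q` in `𝓑(C_p)`. -/

/-! ### Integral spectra of commuting endomorphisms. -/

theorem exists_hasEigenvalue_of_commute_add {V : Type*} [AddCommGroup V] [Module ℂ V]
    [FiniteDimensional ℂ V] {f g : Module.End ℂ V} (hfg : Commute f g) {μ : ℂ}
    (hμ : (f + g).HasEigenvalue μ) :
    ∃ ν : ℂ, f.HasEigenvalue ν ∧ g.HasEigenvalue (μ - ν) := by
  have hinv : ∀ x ∈ (f + g).eigenspace μ, f x ∈ (f + g).eigenspace μ := by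
    intro x hx
    rw [Module.End.mem_eigenspace_iff] at hx ⊢
    have hc : Commute (f + g) f := (Commute.refl f).add_left hfg.symm
    rw [← Module.End.mul_apply, hc.eq, Module.End.mul_apply, hx, map_smul]
  have : Nontrivial ((f + g).eigenspace μ) := Submodule.nontrivial_iff_ne_bot.2 hμ
  -- An eigenvector of `f` inside the `μ`-eigenspace of `f + g` is one of `g` too.
  obtain ⟨ν, hν⟩ := Module.End.exists_eigenvalue (f.restrict hinv)
  obtain ⟨⟨w, hw⟩, hwν⟩ := hν.exists_hasEigenvector
  have hw0 : w ≠ 0 := fun h => hwν.2 (Subtype.ext h)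
  have hfw : f w = ν • w := congrArg Subtype.val hwν.apply_eq_smul
  rw [Module.End.mem_eigenspace_iff] at hw
  refine ⟨ν, Module.End.hasEigenvalue_of_hasEigenvector
    ⟨Module.End.mem_eigenspace_iff.2 hfw, hw0⟩,
    Module.End.hasEigenvalue_of_hasEigenvector ⟨Module.End.mem_eigenspace_iff.2 ?_, hw0⟩⟩
  rw [LinearMap.add_apply, hfw] at hw
  rw [sub_smul, ← hw, add_sub_cancel_left]

/-- All eigenvalues of a complex endomorphism are integers. -/
def HasIntegralSpectrum {V : Type*} [AddCommGroup V] [Module ℂ V] (f : Module.End ℂ V) : Prop :=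
  ∀ μ : ℂ, f.HasEigenvalue μ → ∃ n : ℤ, μ = (n : ℂ)

namespace HasIntegralSpectrum

variable {V : Type*} [AddCommGroup V] [Module ℂ V] {f g : Module.End ℂ V}

theorem add [FiniteDimensional ℂ V] (hf : HasIntegralSpectrum f) (hg : HasIntegralSpectrum g)
    (hfg : Commute f g) : HasIntegralSpectrum (f + g) := by
  intro μ hμ
  obtain ⟨ν, hν, hμν⟩ := exists_hasEigenvalue_of_commute_add hfg hμ
  obtain ⟨m, rfl⟩ := hf ν hν
  obtain ⟨n, hn⟩ := hg _ hμν
  exact ⟨m + n, by rw [Int.cast_add, ← hn, add_sub_cancel]⟩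

theorem neg (hf : HasIntegralSpectrum f) : HasIntegralSpectrum (-f) := by
  intro μ hμ
  obtain ⟨v, hv⟩ := hμ.exists_hasEigenvector
  obtain ⟨n, hn⟩ := hf (-μ) (Module.End.hasEigenvalue_of_hasEigenvector
    ⟨Module.End.mem_eigenspace_iff.2 (by
      rw [neg_smul, ← hv.apply_eq_smul, LinearMap.neg_apply, neg_neg]), hv.2⟩)
  exact ⟨-n, by rw [Int.cast_neg, ← hn, neg_neg]⟩

theorem zero : HasIntegralSpectrum (0 : Module.End ℂ V) := by
  intro μ hμ
  obtain ⟨v, hv⟩ := hμ.exists_hasEigenvector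
  have h := hv.apply_eq_smul
  rw [LinearMap.zero_apply, eq_comm, smul_eq_zero] at h
  exact ⟨0, by simpa using h.resolve_right hv.2⟩

theorem of_mul_self_eq_smul {n : ℤ} (h : f * f = (n : ℂ) • f) : HasIntegralSpectrum f := by
  intro μ hμ
  obtain ⟨v, hv⟩ := hμ.exists_hasEigenvector
  have hf := hv.apply_eq_smul
  have h2 : (μ * μ - n * μ) • v = 0 := by
    have := congrArg (fun T : Module.End ℂ V => T v) h
    simp only [Module.End.mul_apply, LinearMap.smul_apply, hf, map_smul, smul_smul] at this
    rw [sub_smul, this, sub_self]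
  have h3 : (μ - n) * μ = 0 := by
    rw [← (smul_eq_zero.1 h2).resolve_right hv.2]; ring
  rcases mul_eq_zero.1 h3 with h4 | h4
  · exact ⟨n, sub_eq_zero.1 h4⟩
  · exact ⟨0, by simpa using h4⟩

end HasIntegralSpectrum

/-! ### Convolution operators; membership in `𝓑(G)` implies integrality. -/

section Convolution

variable {G : Type*} [Group G]

/-- The matrix of left convolution by an integer valued function on a group. -/
def convMatrix (f : G → ℤ) : Matrix G G ℂ :=
  Matrix.of fun x y => (f (x * y⁻¹) : ℂ)

/-- The indicator function of a set, with values in the integers. -/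
noncomputable def intIndicator {X : Type*} (S : Set X) : X → ℤ :=
  S.indicator 1

theorem convMatrix_intIndicator (S : Set G) : convMatrix (intIndicator S) = cayleyAdjMatrix S := by
  classical
  ext x y
  simp only [convMatrix, intIndicator, cayleyAdjMatrix, CayleyAdj, Matrix.of_apply,
    Set.indicator_apply, Pi.one_apply]
  by_cases h : x * y⁻¹ ∈ S <;> simp [h]

/-- Indicators of normal subgroups are closed under products (`N ∩ K`) and include 1, so the ring
they generate is just their additive span. -/
theorem intIndicator_mem_addSubgroup_closure {S : Set G} (hS : S ∈ normalBoolAlg G) :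
    intIndicator S ∈ AddSubgroup.closure
      {f : G → ℤ | ∃ N : Subgroup G, N.Normal ∧ f = intIndicator (N : Set G)} := by
  classical
  let M : Submonoid (G → ℤ) :=
    { carrier := {f | ∃ N : Subgroup G, N.Normal ∧ f = intIndicator (N : Set G)}
      one_mem' := ⟨⊤, inferInstance, by simp [intIndicator]⟩
      mul_mem' := by
        rintro _ _ ⟨N, hN, rfl⟩ ⟨K, hK, rfl⟩
        refine ⟨N ⊓ K, inferInstance, ?_⟩
        ext x
        by_cases h1 : x ∈ N <;> by_cases h2 : x ∈ K <;> simp [intIndicator, h1, h2] }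
  have key : intIndicator S ∈ Subring.closure (M : Set (G → ℤ)) := by
    refine BooleanSubalgebra.closure_bot_sup_induction
      (p := fun T _ => intIndicator T ∈ Subring.closure (M : Set (G → ℤ))) ?_ ?_ ?_ ?_ hS
    · rintro _ ⟨N, hN, rfl⟩
      exact Subring.subset_closure ⟨N, hN, rfl⟩
    · have : intIndicator (⊥ : Set G) = 0 := Set.indicator_empty 1
      rw [this]
      exact zero_mem _
    · intro T _ U _ hT hU
      have : intIndicator (T ⊔ U) =
          intIndicator T + intIndicator U - intIndicator T * intIndicator U := by
        ext x
        by_cases h1 : x ∈ T <;> by_cases h2 : x ∈ U <;> simp [intIndicator, h1, h2]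
      rw [this]
      exact sub_mem (add_mem hT hU) (mul_mem hT hU)
    · intro T _ hT
      have : intIndicator Tᶜ = 1 - intIndicator T := by
        ext x
        by_cases h1 : x ∈ T <;> simp [intIndicator, h1]
      rw [this]
      exact sub_mem (one_mem _) hT
  rw [Subring.mem_closure_iff, Submonoid.closure_eq] at key
  exact key

variable [Fintype G]

theorem convMatrix_commute (f : G → ℤ) {h : G → ℤ} (hh : ∀ x y, h (x * y) = h (y * x)) :
    Commute (convMatrix f) (convMatrix h) := by
  ext x z
  simp only [Matrix.mul_apply, convMatrix, Matrix.of_apply]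
  -- The involution-like substitution `y ↦ x y⁻¹ z` exchanges the two factors of the convolution.
  refine Fintype.sum_equiv
    ⟨fun y => x * y⁻¹ * z, fun y => z * y⁻¹ * x, fun y => by group, fun y => by group⟩ _ _ ?_
  intro y
  simp only [Equiv.coe_fn_mk]
  rw [mul_comm, show x * y⁻¹ * z * z⁻¹ = x * y⁻¹ by group,
    show x * (x * y⁻¹ * z)⁻¹ = x * (z⁻¹ * y * x⁻¹) by group, hh x,
    show z⁻¹ * y * x⁻¹ * x = z⁻¹ * y by group, hh z⁻¹]

theorem convMatrix_intIndicator_mul_self (N : Subgroup G) :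
    convMatrix (intIndicator (N : Set G)) * convMatrix (intIndicator (N : Set G)) =
      ((∑ g, intIndicator (N : Set G) g : ℤ) : ℂ) • convMatrix (intIndicator (N : Set G)) := by
  classical
  ext x z
  simp only [Matrix.mul_apply, convMatrix, Matrix.of_apply, Matrix.smul_apply, smul_eq_mul,
    Int.cast_sum, Finset.sum_mul]
  refine Fintype.sum_equiv ((Equiv.inv G).trans (Equiv.mulLeft x)) _ _ ?_
  intro y
  simp only [intIndicator, Set.indicator_apply, SetLike.mem_coe, Equiv.trans_apply,
    Equiv.inv_apply, Equiv.coe_mulLeft, Pi.one_apply]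
  by_cases h : x * y⁻¹ ∈ N
  · have : y * z⁻¹ ∈ N ↔ x * z⁻¹ ∈ N := by
      rw [show x * z⁻¹ = x * y⁻¹ * (y * z⁻¹) by group]
      exact (N.mul_mem_cancel_left h).symm
    simp only [h, this]
  · simp [h]

theorem cayleyIntegral_of_mem_normalBoolAlg {S : Set G} (hS : S ∈ normalBoolAlg G) :
    CayleyIntegral S := by
  classical
  -- Being a class function is carried through the induction because the sum step needs commuting
  -- operators.
  suffices h : (∀ x y, intIndicator S (x * y) = intIndicator S (y * x)) ∧
      HasIntegralSpectrum (Matrix.toLin' (convMatrix (intIndicator S))) by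
    rw [CayleyIntegral, ← convMatrix_intIndicator]
    intro μ hμ
    exact h.2 μ (by convert hμ)
  refine AddSubgroup.closure_induction (p := fun f _ => (∀ x y, f (x * y) = f (y * x)) ∧
      HasIntegralSpectrum (Matrix.toLin' (convMatrix f))) ?_ ?_ ?_ ?_
      (intIndicator_mem_addSubgroup_closure hS)
  · rintro _ ⟨N, hN, rfl⟩
    refine ⟨fun x y => ?_, .of_mul_self_eq_smul (n := ∑ g, intIndicator (N : Set G) g) ?_⟩
    · simp only [intIndicator, Set.indicator_apply, SetLike.mem_coe, hN.mem_comm_iff (a := x),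
        Pi.one_apply]
    · rw [Module.End.mul_eq_comp, ← Matrix.toLin'_mul, convMatrix_intIndicator_mul_self, map_smul]
  · refine ⟨fun _ _ => rfl, ?_⟩
    have : convMatrix (0 : G → ℤ) = 0 := by ext; simp [convMatrix]
    rw [this, map_zero]
    exact .zero
  · rintro f h _ _ ⟨hf, hf'⟩ ⟨hh, hh'⟩
    refine ⟨fun x y => by simp [hf x, hh x], ?_⟩
    have : convMatrix (f + h) = convMatrix f + convMatrix h := by ext; simp [convMatrix]
    rw [this, map_add]
    refine hf'.add hh' ?_
    rw [commute_iff_eq, Module.End.mul_eq_comp, Module.End.mul_eq_comp, ← Matrix.toLin'_mul,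
      ← Matrix.toLin'_mul, (convMatrix_commute f hh).eq]
  · rintro f _ ⟨hf, hf'⟩
    refine ⟨fun x y => by simp [hf x], ?_⟩
    have : convMatrix (-f) = -convMatrix f := by ext; simp [convMatrix]
    rw [this, map_neg]
    exact hf'.neg

end Convolution

/-! ### Sets in the Boolean algebra of normal subgroups. -/

section NormalBoolAlg

variable {G H : Type*} [Group G] [Group H]

theorem subgroup_mem_normalBoolAlg (N : Subgroup G) [hN : N.Normal] :
    (N : Set G) ∈ normalBoolAlg G :=
  BooleanSubalgebra.subset_closure ⟨N, hN, rfl⟩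

theorem preimage_mem_normalBoolAlg (f : G →* H) {T : Set H} (hT : T ∈ normalBoolAlg H) :
    f ⁻¹' T ∈ normalBoolAlg G := by
  refine BooleanSubalgebra.closure_bot_sup_induction
    (p := fun T _ => f ⁻¹' T ∈ normalBoolAlg G) ?_ ?_ ?_ ?_ hT
  · rintro _ ⟨N, hN, rfl⟩
    exact subgroup_mem_normalBoolAlg (N.comap f)
  · exact BooleanSubalgebra.bot_mem
  · intro T _ U _ hT hU
    exact BooleanSubalgebra.sup_mem hT hU
  · intro T _ hT
    exact BooleanSubalgebra.compl_mem hT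

theorem singleton_one_mem_normalBoolAlg : ({1} : Set G) ∈ normalBoolAlg G :=
  subgroup_mem_normalBoolAlg (⊥ : Subgroup G)

/-- A set that contains all or none of the nonidentity elements lies in the Boolean algebra
generated by the normal subgroups. -/
theorem mem_normalBoolAlg_of_forall_ne_one {B : Set G}
    (hB : ∀ x y : G, x ≠ 1 → y ≠ 1 → x ∈ B → y ∈ B) : B ∈ normalBoolAlg G := by
  have h1 : ({1} : Set G) ∈ normalBoolAlg G := singleton_one_mem_normalBoolAlg
  by_cases hx : ∃ x ∈ B, x ≠ 1
  · obtain ⟨x, hxB, hx1⟩ := hx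
    by_cases h : (1 : G) ∈ B
    · have : B = ⊤ := Set.eq_univ_of_forall fun y => by
        by_cases hy : y = 1
        · rwa [hy]
        · exact hB x y hx1 hy hxB
      rw [this]
      exact BooleanSubalgebra.top_mem
    · have : B = ({1} : Set G)ᶜ := by
        ext y
        by_cases hy : y = 1
        · simp [hy, h]
        · simpa [hy] using hB x y hx1 hy hxB
      rw [this]
      exact BooleanSubalgebra.compl_mem h1
  · push Not at hx
    by_cases h : (1 : G) ∈ B
    · have : B = {1} := Set.eq_singleton_iff_unique_mem.2 ⟨h, hx⟩
      rwa [this]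
    · have : B = ⊥ := Set.eq_empty_of_forall_notMem fun y hy => h (hx y hy ▸ hy)
      rw [this]
      exact BooleanSubalgebra.bot_mem

end NormalBoolAlg

/-! ### Subgroups of `Q₈` and decomposition into boxes. -/

namespace Q8

/-- Makes membership a decidable disjunction, so that normality and the set identities below reduce
to `decide`. -/
theorem mem_zpowers_iff (q x : Q8) :
    x ∈ Subgroup.zpowers q ↔ x = 1 ∨ x = q ∨ x = q ^ 2 ∨ x = q ^ 3 := by
  have h4 : q ^ 4 = 1 := by revert q; decide
  constructor
  · rintro ⟨n, rfl⟩
    have h4' : q ^ (4 : ℤ) = 1 := by exact_mod_cast h4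
    have hn : q ^ n = q ^ (n % 4) := by
      conv_lhs => rw [← Int.emod_add_mul_ediv n 4, zpow_add, zpow_mul, h4', one_zpow, mul_one]
    have h0 : 0 ≤ n % 4 := Int.emod_nonneg _ (by norm_num)
    have h1 : n % 4 < 4 := Int.emod_lt_of_pos _ (by norm_num)
    simp only [hn]
    generalize n % 4 = k at h0 h1
    interval_cases k
    · exact Or.inl (zpow_zero q)
    · exact Or.inr (Or.inl (zpow_one q))
    · exact Or.inr (Or.inr (Or.inl (zpow_ofNat q 2)))
    · exact Or.inr (Or.inr (Or.inr (zpow_ofNat q 3)))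
  · rintro (rfl | rfl | rfl | rfl)
    · exact one_mem _
    · exact Subgroup.mem_zpowers _
    · exact pow_mem (Subgroup.mem_zpowers _) _
    · exact pow_mem (Subgroup.mem_zpowers _) _

instance zpowers_normal (q : Q8) : (Subgroup.zpowers q).Normal where
  conj_mem x hx g := by
    rw [mem_zpowers_iff] at hx ⊢
    revert q x g
    decide

theorem singleton_negOne_mem_normalBoolAlg : ({negOne} : Set Q8) ∈ normalBoolAlg Q8 := by
  have : ({negOne} : Set Q8) = (Subgroup.zpowers negOne : Set Q8) \ {1} := by
    ext x
    rw [Set.mem_sdiff, SetLike.mem_coe, mem_zpowers_iff, Set.mem_singleton_iff,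
      Set.mem_singleton_iff]
    revert x
    decide
  rw [this]
  exact BooleanSubalgebra.sdiff_mem (subgroup_mem_normalBoolAlg _) singleton_one_mem_normalBoolAlg

theorem pair_mem_normalBoolAlg {q : Q8} (h1 : q ≠ 1) (h2 : q ≠ negOne) :
    ({q, negOne * q} : Set Q8) ∈ normalBoolAlg Q8 := by
  have : ({q, negOne * q} : Set Q8) =
      (Subgroup.zpowers q : Set Q8) \ (Subgroup.zpowers negOne : Set Q8) := by
    ext x
    rw [Set.mem_sdiff, SetLike.mem_coe, SetLike.mem_coe, mem_zpowers_iff, mem_zpowers_iff,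
      Set.mem_insert_iff, Set.mem_singleton_iff]
    revert q x
    decide
  rw [this]
  exact BooleanSubalgebra.sdiff_mem (subgroup_mem_normalBoolAlg _) (subgroup_mem_normalBoolAlg _)

end Q8

theorem mem_normalBoolAlg_of_fibre {A : Type*} [Group A] {S : Set (Q8 × A)}
    (h1 : fibre S 1 ∈ normalBoolAlg A) (h2 : fibre S Q8.negOne ∈ normalBoolAlg A)
    (h : ∀ q : Q8, q ≠ 1 → q ≠ Q8.negOne →
      fibre S q = fibre S (Q8.negOne * q) ∧ fibre S q ∈ normalBoolAlg A) :
    S ∈ normalBoolAlg (Q8 × A) := by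
  have key : ∀ q : Q8, ∃ T : Set (Q8 × A), T ∈ normalBoolAlg (Q8 × A) ∧ T ⊆ S ∧
      ∀ a, (q, a) ∈ S → (q, a) ∈ T := by
    have box : ∀ {C : Set Q8} {B : Set A}, C ∈ normalBoolAlg Q8 → B ∈ normalBoolAlg A →
        MonoidHom.fst Q8 A ⁻¹' C ⊓ MonoidHom.snd Q8 A ⁻¹' B ∈ normalBoolAlg (Q8 × A) :=
      fun hC hB => BooleanSubalgebra.inf_mem (preimage_mem_normalBoolAlg _ hC)
        (preimage_mem_normalBoolAlg _ hB)
    intro q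
    by_cases hq1 : q = 1
    · subst hq1
      refine ⟨_, box singleton_one_mem_normalBoolAlg h1, ?_, fun a ha => ⟨rfl, ha⟩⟩
      rintro ⟨r, a⟩ ⟨rfl, ha⟩
      exact ha
    by_cases hq2 : q = Q8.negOne
    · subst hq2
      refine ⟨_, box Q8.singleton_negOne_mem_normalBoolAlg h2, ?_, fun a ha => ⟨rfl, ha⟩⟩
      rintro ⟨r, a⟩ ⟨rfl, ha⟩
      exact ha
    obtain ⟨h3, h4⟩ := h q hq1 hq2
    refine ⟨_, box (Q8.pair_mem_normalBoolAlg hq1 hq2) h4, ?_, fun a ha => ⟨Or.inl rfl, ha⟩⟩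
    rintro ⟨r, a⟩ ⟨rfl | rfl, ha⟩
    · exact ha
    · have ha' : a ∈ fibre S q := ha
      rw [h3] at ha'
      exact ha'
  choose T hT hTS hST using key
  have : S = Finset.univ.sup T := by
    refine le_antisymm ?_ (Finset.sup_le fun q _ => hTS q)
    rintro ⟨q, a⟩ hqa
    exact Finset.le_sup (f := T) (Finset.mem_univ q) (hST q a hqa)
  rw [this]
  exact Finset.sup_induction BooleanSubalgebra.bot_mem
    (fun _ hU _ hV => BooleanSubalgebra.sup_mem hU hV) fun q _ => hT q

/-! ### Arithmetic of `p`-th roots of unity. -/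

open Polynomial in
/-- The only rational linear relations between the powers `ζ ^ i`, `i < p`, of a primitive `p`-th
root of unity are the multiples of `1 + ζ + ⋯ + ζ ^ (p - 1) = 0`. -/
theorem IsPrimitiveRoot.eq_of_sum_mul_pow_eq_zero {p : ℕ} [Fact p.Prime] {ζ : ℂ}
    (hζ : IsPrimitiveRoot ζ p) {c : ZMod p → ℚ} (h : ∑ a, (c a : ℂ) * ζ ^ a.val = 0)
    (a b : ZMod p) : c a = c b := by
  have hp : p.Prime := Fact.out
  set P : ℚ[X] := ∑ a : ZMod p, C (c a) * X ^ a.val with hP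
  have hcoeff : ∀ a : ZMod p, P.coeff a.val = c a := by
    intro a
    rw [hP, finsetSum_coeff, Finset.sum_eq_single a]
    · simp
    · intro b _ hb
      rw [coeff_C_mul_X_pow, if_neg fun h => hb (ZMod.val_injective p h).symm]
    · simp
  have hdeg : P.natDegree ≤ p - 1 := by
    refine natDegree_sum_le_of_forall_le _ _ fun a _ => ?_
    exact (natDegree_C_mul_X_pow_le _ _).trans (Nat.le_sub_one_of_lt a.val_lt)
  have hdvd : cyclotomic p ℚ ∣ P := by
    rw [cyclotomic_eq_minpoly_rat hζ hp.pos]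
    refine minpoly.dvd _ _ ?_
    simpa [hP, map_sum] using h
  obtain ⟨Q, hQ⟩ := hdvd
  have hconst : ∃ k : ℚ, P = cyclotomic p ℚ * C k := by
    by_cases hQ0 : Q = 0
    · exact ⟨0, by simp [hQ, hQ0]⟩
    have h1 : P.natDegree = (p - 1) + Q.natDegree := by
      rw [hQ, natDegree_mul (cyclotomic_ne_zero p ℚ) hQ0, natDegree_cyclotomic,
        Nat.totient_prime hp]
    obtain ⟨k, hk⟩ := natDegree_eq_zero.1 (show Q.natDegree = 0 by omega)
    exact ⟨k, by rw [hQ, hk]⟩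
  obtain ⟨k, hk⟩ := hconst
  have : ∀ a : ZMod p, c a = k := by
    intro a
    rw [← hcoeff, hk, coeff_mul_C, cyclotomic_prime, finsetSum_coeff,
      Finset.sum_eq_single a.val]
    · simp
    · intro b _ hb
      rw [coeff_X_pow, if_neg hb.symm]
    · intro h
      exact absurd (Finset.mem_range.2 a.val_lt) h
  rw [this a, this b]

theorem IsPrimitiveRoot.eq_of_sum_mul_pow_eq_rat {p : ℕ} [Fact p.Prime] {ζ : ℂ}
    (hζ : IsPrimitiveRoot ζ p) {c : ZMod p → ℚ} {r : ℚ} (h : ∑ a, (c a : ℂ) * ζ ^ a.val = r)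
    {a : ZMod p} (ha : a ≠ 0) : c a = c 0 - r ∧ ∀ b ≠ 0, c b = c a := by
  -- Absorb `r` into the coefficient of `ζ ^ 0`.
  have key := hζ.eq_of_sum_mul_pow_eq_zero (c := fun a => c a - if a = 0 then r else 0) (by
    simp only [Rat.cast_sub, sub_mul, Finset.sum_sub_distrib, h]
    rw [Finset.sum_eq_single (0 : ZMod p)]
    · simp
    · intro b _ hb
      simp [hb]
    · simp)
  refine ⟨?_, fun b hb => ?_⟩
  · simpa [ha] using key a 0
  · simpa [ha, hb] using key b a

/-- If `f₁, …, f₃` are odd functions on `ZMod p` with values in `{-1, 0, 1}`, and the squares of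
their Fourier coefficients at a nontrivial character add up to `-(m / 2) ^ 2`, then they vanish. -/
theorem eq_zero_of_odd_of_sum_sq {p : ℕ} [Fact p.Prime] (hp3 : p ≠ 3) {ζ : ℂ}
    (hζ : IsPrimitiveRoot ζ p) {f : Fin 3 → ZMod p → ℤ} (hodd : ∀ i a, f i (-a) = -f i a)
    (hf : ∀ i a, f i a ^ 2 ≤ 1) {m : ℤ}
    (h : 4 * ∑ i, (∑ a, (f i a : ℂ) * ζ ^ a.val) ^ 2 = -(m : ℂ) ^ 2) (i : Fin 3) (a : ZMod p) :
    f i a = 0 := by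
  have hp : p.Prime := Fact.out
  by_cases hp2 : p = 2
  · subst hp2
    have := hodd i a
    rw [ZMod.neg_eq_self_mod_two] at this
    omega
  have hp5 : 5 ≤ p := by
    have h4 : p ≠ 4 := by rintro rfl; revert hp; decide
    have := hp.two_le
    omega
  have hf0 : ∀ i, f i 0 = 0 := by
    intro i
    have := hodd i 0
    rw [neg_zero] at this
    omega
  -- The sum of the self-convolutions: its Fourier coefficient is the sum of squares in `h`, so it
  -- is rational and `F` is constant off 0.
  let F : ZMod p → ℤ := fun c => ∑ i, ∑ a, f i a * f i (c - a)
  have hFζ : ∑ c, ((F c : ℚ) : ℂ) * ζ ^ c.val = ((-(m ^ 2) / 4 : ℚ) : ℂ) := by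
    have h1 : ∑ c, ((F c : ℚ) : ℂ) * ζ ^ c.val =
        ∑ i, (∑ a, (f i a : ℂ) * ζ ^ a.val) ^ 2 := by
      simp only [F, Int.cast_sum, Int.cast_mul, Rat.cast_sum, Rat.cast_mul, Rat.cast_intCast,
        Finset.sum_mul]
      rw [Finset.sum_comm]
      refine Finset.sum_congr rfl fun i _ => ?_
      rw [Finset.sum_comm, sq, Finset.sum_mul_sum]
      refine Finset.sum_congr rfl fun a _ => ?_
      refine Fintype.sum_equiv (Equiv.subRight a) _ _ fun c => ?_
      have := (AddChar.zmodChar p hζ.pow_eq_one).map_add_eq_mul a (c - a)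
      rw [add_sub_cancel] at this
      simp only [AddChar.zmodChar_apply] at this
      rw [Equiv.subRight_apply, this]
      ring
    rw [h1]
    push_cast
    linear_combination h / 4
  have hsum : ∑ c, F c = 0 := by
    have h0 : ∀ i, ∑ a, f i a = 0 := by
      intro i
      have : ∑ a, f i a = ∑ a, -f i a :=
        Fintype.sum_equiv (Equiv.neg _) _ _ fun a => by simp [hodd]
      rw [Finset.sum_neg_distrib] at this
      omega
    simp only [F]
    rw [Finset.sum_comm]
    refine Finset.sum_eq_zero fun i _ => ?_
    rw [Finset.sum_comm]
    refine Finset.sum_eq_zero fun a _ => ?_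
    rw [← Finset.mul_sum, Fintype.sum_equiv (Equiv.subRight a) (fun c => f i (c - a)) (f i)
      fun c => rfl, h0, mul_zero]
  have hF0 : F 0 = -∑ i, ∑ a, f i a ^ 2 := by
    simp only [F, zero_sub, hodd, ← Finset.sum_neg_distrib]
    exact Finset.sum_congr rfl fun i _ => Finset.sum_congr rfl fun a _ => by ring
  have hcard : ((Finset.univ.erase (0 : ZMod p)).card : ℤ) = p - 1 := by
    rw [Finset.card_erase_of_mem (Finset.mem_univ _), Finset.card_univ, ZMod.card,
      Nat.cast_sub hp.one_le, Nat.cast_one]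
  have hbound : ∑ i, ∑ a, f i a ^ 2 ≤ 3 * (p - 1 : ℤ) := by
    have : ∀ i, ∑ a, f i a ^ 2 ≤ (p - 1 : ℤ) := by
      intro i
      rw [← Finset.add_sum_erase _ _ (Finset.mem_univ (0 : ZMod p)), hf0, ← hcard]
      simpa using Finset.sum_le_sum fun a (_ : a ∈ Finset.univ.erase (0 : ZMod p)) => hf i a
    refine (Finset.sum_le_sum fun i (_ : i ∈ Finset.univ) => this i).trans_eq ?_
    rw [Finset.sum_const, Finset.card_univ, Fintype.card_fin, nsmul_eq_mul, Nat.cast_ofNat]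
  have : Fact (1 < p) := ⟨hp.one_lt⟩
  obtain ⟨h2, h3⟩ := hζ.eq_of_sum_mul_pow_eq_rat (c := fun c => (F c : ℚ)) hFζ
    (one_ne_zero : (1 : ZMod p) ≠ 0)
  set t : ℤ := F 1 with ht
  have h4 : F 0 + (p - 1) * t = 0 := by
    rw [← hsum, ← Finset.add_sum_erase _ _ (Finset.mem_univ (0 : ZMod p)), ← hcard,
      ← nsmul_eq_mul, ← Finset.sum_const]
    congr 1
    refine Finset.sum_congr rfl fun c hc => ?_
    exact_mod_cast (h3 c (Finset.ne_of_mem_erase hc)).symm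
  -- Combines `F 0 = -(p - 1) t` with `t - F 0 = m² / 4`.
  have h5 : 4 * (p * t) = m ^ 2 := by
    have h6 : 4 * (t - F 0) = m ^ 2 := by
      have : (4 * (t - F 0) : ℚ) = m ^ 2 := by linear_combination 4 * h2
      exact_mod_cast this
    linear_combination h6 + 4 * h4
  have hp5' : (5 : ℤ) ≤ p := by exact_mod_cast hp5
  have ht0 : 0 ≤ t := by
    by_contra! hneg
    nlinarith [sq_nonneg m]
  -- By `hbound`, `(p - 1) t = -F 0 ≤ 3 (p - 1)`. Together with `p ∣ t` and `p ≥ 5` this leaves only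
  -- `t = 0`; for `p = 3` the value `t = 3` would survive.
  have ht3 : t ≤ 3 := by
    by_contra! hgt
    nlinarith
  have hpp : Prime (p : ℤ) := Nat.prime_iff_prime_int.1 hp
  have hdvd : (p : ℤ) ∣ t := by
    have h7 : (p : ℤ) ∣ m := hpp.dvd_of_dvd_pow (n := 2) ⟨4 * t, by rw [← h5]; ring⟩
    obtain ⟨k, rfl⟩ := h7
    have h8 : (4 : ℤ) * t = p * k ^ 2 := by
      refine mul_left_cancel₀ hpp.ne_zero ?_
      linear_combination h5
    have h9 : (p : ℤ) ∣ 4 * t := ⟨_, h8⟩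
    refine (hpp.dvd_or_dvd h9).resolve_left fun h10 => ?_
    have := Int.le_of_dvd (by norm_num) h10
    omega
  have ht : t = 0 := Int.eq_zero_of_dvd_of_nonneg_of_lt ht0 (by omega) hdvd
  rw [ht, mul_zero, add_zero, hF0, neg_eq_zero,
    Finset.sum_eq_zero_iff_of_nonneg fun i _ => Finset.sum_nonneg fun a _ => sq_nonneg _] at h4
  have h11 := h4 i (Finset.mem_univ i)
  rw [Finset.sum_eq_zero_iff_of_nonneg fun a _ => sq_nonneg _] at h11
  exact pow_eq_zero_iff two_ne_zero |>.1 (h11 a (Finset.mem_univ a))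

/-! ### Eigenvalues from representations; homomorphisms out of `Q₈`. -/

open scoped Matrix in
/-- An eigenvalue of `∑ g ∈ S, R g`, for a matrix representation `R` of `G`, is an eigenvalue of
the Cayley graph of `G` over `S`. -/
theorem CayleyIntegral.exists_int_of_det_eq_zero {G : Type*} [Group G] [Fintype G] {S : Set G}
    (hS : CayleyIntegral S) {n : Type*} [Fintype n] [DecidableEq n] (R : G →* Matrix n n ℂ) {μ : ℂ}
    (hμ : (∑ g, (intIndicator S g : ℂ) • R g - μ • 1).det = 0) : ∃ k : ℤ, μ = k := by
  classical
  obtain ⟨w, hw0, hw⟩ := Matrix.exists_mulVec_eq_zero_iff.2 hμ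
  rw [Matrix.sub_mulVec, Matrix.smul_mulVec, Matrix.one_mulVec, sub_eq_zero] at hw
  obtain ⟨i, hi⟩ := Function.ne_iff.1 hw0
  -- The eigenfunction is a matrix coefficient; its value at 1 is `w i ≠ 0`.
  refine hS μ (Module.End.hasEigenvalue_of_hasEigenvector
    (x := fun x => (R x⁻¹ *ᵥ w) i) ⟨Module.End.mem_eigenspace_iff.2 ?_, fun h => hi ?_⟩)
  · ext x
    rw [← convMatrix_intIndicator, Matrix.toLin'_apply]
    calc ∑ y, (intIndicator S (x * y⁻¹) : ℂ) * (R y⁻¹ *ᵥ w) i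
        = ∑ g, (intIndicator S g : ℂ) * (R (x⁻¹ * g) *ᵥ w) i :=
          Fintype.sum_equiv ((Equiv.inv G).trans (Equiv.mulLeft x)) _ _ fun y => by simp
      _ = (R x⁻¹ *ᵥ ((∑ g, (intIndicator S g : ℂ) • R g) *ᵥ w)) i := by
          rw [Matrix.mulVec_mulVec, Finset.mul_sum, Matrix.sum_mulVec, Finset.sum_apply]
          refine Finset.sum_congr rfl fun g _ => ?_
          rw [mul_smul_comm, ← map_mul, Matrix.smul_mulVec, Pi.smul_apply, smul_eq_mul]
      _ = μ * (R x⁻¹ *ᵥ w) i := by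
          rw [hw, Matrix.mulVec_smul, Pi.smul_apply, smul_eq_mul]
  · simpa using congrFun h 1

namespace Q8

/-- The homomorphism from the quaternion group given by a pair satisfying its relations. -/
def lift {M : Type*} [Monoid M] (A X : M) (hA : A ^ 4 = 1) (hX : X * X = A ^ 2)
    (hAX : A * X = X * A ^ 3) : Q8 →* M :=
  have hval : ∀ n : ℕ, A ^ (n : ZMod (2 * 2)).val = A ^ n := fun n => by
    rw [ZMod.val_natCast]
    exact (pow_eq_pow_mod n hA).symm
  have hswap : ∀ n : ℕ, A ^ n * X = X * A ^ (3 * n) := fun n => by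
    induction n with
    | zero => simp
    | succ n ih => rw [pow_succ, mul_assoc, hAX, ← mul_assoc, ih, mul_assoc, ← pow_add]; rfl
  have hadd : ∀ i j : ZMod (2 * 2), A ^ (i + j).val = A ^ (i.val + j.val) := fun i j => by
    rw [← hval (i.val + j.val)]; simp
  have hneg : ∀ i : ZMod (2 * 2), A ^ (-i).val = A ^ (3 * i.val) := fun i => by
    rw [← hval (3 * i.val)]
    congr 2
    revert i
    decide
  have hsub : ∀ i j : ZMod (2 * 2), A ^ (j - i).val = A ^ (3 * i.val + j.val) := fun i j => by
    rw [sub_eq_neg_add, hadd, pow_add, hneg, pow_add]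
  { toFun := fun q => match q with
      | .a i => A ^ i.val
      | .xa i => X * A ^ i.val
    map_one' := pow_zero A
    map_mul' := by
      rintro (i | i) (j | j)
      · change A ^ (i + j).val = A ^ i.val * A ^ j.val
        rw [hadd, pow_add]
      · change X * A ^ (j - i).val = A ^ i.val * (X * A ^ j.val)
        rw [hsub, ← mul_assoc, hswap, mul_assoc, pow_add]
      · change X * A ^ (i + j).val = X * A ^ i.val * A ^ j.val
        rw [hadd, pow_add, mul_assoc]
      · change A ^ (2 + j - i).val = X * A ^ i.val * (X * A ^ j.val)
        rw [hsub, mul_assoc, ← mul_assoc _ X, hswap, mul_assoc, ← mul_assoc X, hX, ← pow_add,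
          ← pow_add, pow_add _ (3 * i.val), hadd, ← pow_add]
        congr 1
        have : (2 : ZMod (2 * 2)).val = 2 := rfl
        omega }

theorem sum_eq {M : Type*} [AddCommMonoid M] (f : Q8 → M) :
    ∑ q, f q = f (.a 0) + f (.a 1) + f (.a 2) + f (.a 3) +
      (f (.xa 0) + f (.xa 1) + f (.xa 2) + f (.xa 3)) := by
  have : (Finset.univ : Finset Q8) = {.a 0, .a 1, .a 2, .a 3, .xa 0, .xa 1, .xa 2, .xa 3} := by
    decide
  rw [this]
  repeat rw [Finset.sum_insert (by decide)]
  rw [Finset.sum_singleton]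
  simp only [add_assoc]

end Q8

/-! ### Fourier coefficients of the fibres; integrality implies (P1) and (P2). -/

section Fourier

variable {p : ℕ} [Fact p.Prime]

/-- The Fourier coefficient of the fibre of `S` over `q` at the character of `Cyc p` that maps the
generator to `ζ`. -/
noncomputable def fibreCoeff (S : Set (Q8 × Cyc p)) (ζ : ℂ) (q : Q8) : ℂ :=
  ∑ a : ZMod p, (intIndicator (fibre S q) (Multiplicative.ofAdd a) : ℂ) * ζ ^ a.val

theorem CayleyIntegral.exists_int_of_fibreCoeff {S : Set (Q8 × Cyc p)} (hS : CayleyIntegral S)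
    {ζ : ℂ} (hζ : ζ ^ p = 1) {n : Type*} [Fintype n] [DecidableEq n] (ρ : Q8 →* Matrix n n ℂ)
    {μ : ℂ} (hμ : (∑ q, fibreCoeff S ζ q • ρ q - μ • 1).det = 0) : ∃ k : ℤ, μ = k := by
  let χ : Cyc p →* ℂ := (AddChar.zmodChar p hζ).toMonoidHom
  let R : Q8 × Cyc p →* Matrix n n ℂ :=
    { toFun := fun g => χ g.2 • ρ g.1
      map_one' := by simp
      map_mul' := fun g h => by
        rw [Prod.fst_mul, Prod.snd_mul, map_mul, map_mul, smul_mul_smul_comm] }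
  refine hS.exists_int_of_det_eq_zero R ?_
  rw [← hμ, Fintype.sum_prod_type]
  congr 2
  refine Finset.sum_congr rfl fun q _ => ?_
  rw [fibreCoeff, Finset.sum_smul]
  refine Fintype.sum_equiv Multiplicative.toAdd _ _ fun a => ?_
  rw [mul_smul]
  rfl

/-- Evaluation of the one-dimensional representations of `Q8 × Cyc p`. -/
theorem CayleyIntegral.exists_int_of_sign {S : Set (Q8 × Cyc p)} (hS : CayleyIntegral S)
    {ζ : ℂ} (hζ : ζ ^ p = 1) {ε δ : ℂ} (hε : ε ^ 2 = 1) (hδ : δ ^ 2 = 1) :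
    ∃ k : ℤ, (fibreCoeff S ζ (.a 0) + fibreCoeff S ζ (.a 2)) +
      ε * (fibreCoeff S ζ (.a 1) + fibreCoeff S ζ (.a 3)) +
      δ * (fibreCoeff S ζ (.xa 0) + fibreCoeff S ζ (.xa 2)) +
      ε * δ * (fibreCoeff S ζ (.xa 1) + fibreCoeff S ζ (.xa 3)) = k := by
  have h4 : ε ^ 4 = 1 := by linear_combination (ε ^ 2 + 1) * hε
  let ρ : Q8 →* ℂ := Q8.lift ε δ h4 (by rw [← sq, hε, hδ]) (by linear_combination -ε * δ * hε)
  refine hS.exists_int_of_fibreCoeff hζ (n := Unit)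
    ((Matrix.scalar Unit : ℂ →+* _).toMonoidHom.comp ρ) ?_
  have e0 : ρ (.a 0) = 1 := pow_zero ε
  have e1 : ρ (.a 1) = ε := pow_one ε
  have e2 : ρ (.a 2) = 1 := hε
  have e3 : ρ (.a 3) = ε := by
    change ε ^ 3 = ε
    linear_combination ε * hε
  have e4 : ρ (.xa 0) = δ := by
    change δ * ε ^ 0 = δ
    rw [pow_zero, mul_one]
  have e5 : ρ (.xa 1) = ε * δ := by
    change δ * ε ^ 1 = ε * δ
    rw [pow_one, mul_comm]
  have e6 : ρ (.xa 2) = δ := by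
    change δ * ε ^ 2 = δ
    rw [hε, mul_one]
  have e7 : ρ (.xa 3) = ε * δ := by
    change δ * ε ^ 3 = ε * δ
    linear_combination ε * δ * hε
  rw [Q8.sum_eq, Matrix.det_unique]
  simp [-QuaternionGroup.a_zero, e0, e1, e2, e3, e4, e5, e6, e7]
  ring

/-- Evaluation of the two-dimensional representations of `Q8 × Cyc p`. -/
theorem CayleyIntegral.exists_int_of_sq_add {S : Set (Q8 × Cyc p)} (hS : CayleyIntegral S)
    {ζ : ℂ} (hζ : ζ ^ p = 1) {μ : ℂ}
    (hμ : (fibreCoeff S ζ (.a 0) - fibreCoeff S ζ (.a 2) - μ) ^ 2 +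
      (fibreCoeff S ζ (.a 1) - fibreCoeff S ζ (.a 3)) ^ 2 +
      (fibreCoeff S ζ (.xa 0) - fibreCoeff S ζ (.xa 2)) ^ 2 +
      (fibreCoeff S ζ (.xa 1) - fibreCoeff S ζ (.xa 3)) ^ 2 = 0) : ∃ k : ℤ, μ = k := by
  -- Quaternion units as matrices: the determinant of `x₀ + x₁A + x₂X + x₃XA` is the norm form `x₀²
  -- + x₁² + x₂² + x₃²`.
  let A : Matrix (Fin 2) (Fin 2) ℂ := !![Complex.I, 0; 0, -Complex.I]
  let X : Matrix (Fin 2) (Fin 2) ℂ := !![0, -1; 1, 0]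
  have hA2 : A ^ 2 = -1 := by
    rw [sq]
    ext i j
    fin_cases i <;> fin_cases j <;> simp [A]
  have hA3 : A ^ 3 = -A := by rw [pow_succ, hA2, neg_one_mul]
  have hX2 : X * X = -1 := by
    ext i j
    fin_cases i <;> fin_cases j <;> simp [X]
  have hAX : A * X = X * A ^ 3 := by
    rw [hA3]
    ext i j
    fin_cases i <;> fin_cases j <;> simp [A, X]
  have hA4 : A ^ 4 = 1 := by rw [pow_succ, hA3, neg_mul, ← sq, hA2, neg_neg]
  refine hS.exists_int_of_fibreCoeff hζ (Q8.lift A X hA4 (by rw [hX2, hA2]) hAX) ?_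
  set ρ := Q8.lift A X hA4 (by rw [hX2, hA2]) hAX
  have e0 : ρ (.a 0) = 1 := pow_zero A
  have e1 : ρ (.a 1) = A := pow_one A
  have e2 : ρ (.a 2) = -1 := hA2
  have e3 : ρ (.a 3) = -A := hA3
  have e4 : ρ (.xa 0) = X := by
    change X * A ^ 0 = X
    rw [pow_zero, mul_one]
  have e5 : ρ (.xa 1) = X * A := by
    change X * A ^ 1 = X * A
    rw [pow_one]
  have e6 : ρ (.xa 2) = -X := by
    change X * A ^ 2 = -X
    rw [hA2, mul_neg_one]
  have e7 : ρ (.xa 3) = -(X * A) := by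
    change X * A ^ 3 = -(X * A)
    rw [hA3, mul_neg]
  rw [Q8.sum_eq, Matrix.det_fin_two, e0, e1, e2, e3, e4, e5, e6, e7]
  simp [-QuaternionGroup.a_zero, A, X]
  linear_combination hμ - ((fibreCoeff S ζ (.a 1) - fibreCoeff S ζ (.a 3)) ^ 2 +
    (fibreCoeff S ζ (.xa 1) - fibreCoeff S ζ (.xa 3)) ^ 2) * Complex.I_sq

theorem fibreCoeff_sub (S : Set (Q8 × Cyc p)) (ζ : ℂ) (q r : Q8) :
    fibreCoeff S ζ q - fibreCoeff S ζ r =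
      ∑ a : ZMod p, ((intIndicator (fibre S q) (Multiplicative.ofAdd a) -
        intIndicator (fibre S r) (Multiplicative.ofAdd a) : ℤ) : ℂ) * ζ ^ a.val := by
  simp only [fibreCoeff, ← Finset.sum_sub_distrib, Int.cast_sub, sub_mul]

theorem fibre_mem_normalBoolAlg_of_fibreCoeff_eq_rat {S : Set (Q8 × Cyc p)} {ζ : ℂ}
    (hζ : IsPrimitiveRoot ζ p) {q : Q8} {r : ℚ} (h : fibreCoeff S ζ q = r) :
    fibre S q ∈ normalBoolAlg (Cyc p) := by
  refine mem_normalBoolAlg_of_forall_ne_one fun x y hx hy hxB => ?_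
  have := (hζ.eq_of_sum_mul_pow_eq_rat
    (c := fun a => (intIndicator (fibre S q) (Multiplicative.ofAdd a) : ℚ)) (r := r)
    (by simpa [fibreCoeff] using h) (a := x.toAdd) hx).2 y.toAdd hy
  simp only [ofAdd_toAdd, Int.cast_inj] at this
  by_contra hyB
  simp [intIndicator, hxB, hyB] at this

/-- Since `q⁻¹ = -q` for `q ≠ ±1`, this is what makes `1_{B_q} - 1_{B_{-q}}` odd. -/
theorem intIndicator_fibre_inv {S : Set (Q8 × Cyc p)} (hS : ∀ g ∈ S, g⁻¹ ∈ S) (q : Q8)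
    (a : Cyc p) : intIndicator (fibre S q) a⁻¹ = intIndicator (fibre S q⁻¹) a := by
  have : a⁻¹ ∈ fibre S q ↔ a ∈ fibre S q⁻¹ :=
    ⟨fun h => by simpa [fibre] using hS _ h, fun h => by simpa [fibre] using hS _ h⟩
  by_cases h : a ∈ fibre S q⁻¹
  · simp [intIndicator, h, this.2 h]
  · simp [intIndicator, h, mt this.1 h]

theorem CayleyIntegral.intIndicator_fibre_eq {S : Set (Q8 × Cyc p)} (hS : CayleyIntegral S)
    (hp3 : p ≠ 3) (hinv : ∀ g ∈ S, g⁻¹ ∈ S) (i : Fin 3) (a : Cyc p) :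
    intIndicator (fibre S (![.a 1, .xa 0, .xa 1] i)) a =
      intIndicator (fibre S (![.a 3, .xa 2, .xa 3] i)) a := by
  have hζ := Complex.isPrimitiveRoot_exp p (Fact.out : p.Prime).ne_zero
  set ζ := Complex.exp (2 * Real.pi * Complex.I / p)
  set u : Fin 3 → Q8 := ![.a 1, .xa 0, .xa 1] with hu
  set v : Fin 3 → Q8 := ![.a 3, .xa 2, .xa 3] with hv
  have huv : ∀ i, (u i)⁻¹ = v i := by decide
  have hvu : ∀ i, (v i)⁻¹ = u i := by decide
  set D : ℂ := ∑ i, (fibreCoeff S ζ (u i) - fibreCoeff S ζ (v i)) ^ 2 with hD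
  -- The eigenvalues `x₀ ± d` are integers `k`, `l`, so `2d = k - l` and `4D = -(k - l)²`.
  obtain ⟨d, hd⟩ := IsAlgClosed.exists_pow_nat_eq (-D) two_pos
  have hD' := hD
  simp only [Fin.sum_univ_three, hu, hv, Matrix.cons_val_zero, Matrix.cons_val_one,
    Matrix.cons_val] at hD'
  obtain ⟨k, hk⟩ := hS.exists_int_of_sq_add hζ.pow_eq_one
    (μ := fibreCoeff S ζ (.a 0) - fibreCoeff S ζ (.a 2) + d) (by linear_combination hd - hD')
  obtain ⟨l, hl⟩ := hS.exists_int_of_sq_add hζ.pow_eq_one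
    (μ := fibreCoeff S ζ (.a 0) - fibreCoeff S ζ (.a 2) - d) (by linear_combination hd - hD')
  have key := eq_zero_of_odd_of_sum_sq hp3 hζ
    (f := fun i a => intIndicator (fibre S (u i)) (Multiplicative.ofAdd a) -
      intIndicator (fibre S (v i)) (Multiplicative.ofAdd a)) (m := k - l) ?_ ?_ ?_ i a.toAdd
  · simpa [sub_eq_zero] using key
  · intro i a
    rw [ofAdd_neg, intIndicator_fibre_inv hinv, intIndicator_fibre_inv hinv, huv, hvu, neg_sub]
  · intro i a
    by_cases h1 : Multiplicative.ofAdd a ∈ fibre S (u i) <;>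
      by_cases h2 : Multiplicative.ofAdd a ∈ fibre S (v i) <;> simp [intIndicator, h1, h2]
  · simp only [← fibreCoeff_sub, ← hD]
    push_cast
    rw [← hk, ← hl]
    linear_combination 4 * hd

theorem CayleyIntegral.fibre_eq_and_mem {S : Set (Q8 × Cyc p)} (hS : CayleyIntegral S)
    (hp3 : p ≠ 3) (hinv : ∀ g ∈ S, g⁻¹ ∈ S) :
    (∀ q : Q8, q ≠ 1 → q ≠ Q8.negOne → fibre S q = fibre S (Q8.negOne * q)) ∧
      ∀ q : Q8, fibre S q ∈ normalBoolAlg (Cyc p) := by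
  have key := hS.intIndicator_fibre_eq hp3 hinv
  have hfib : ∀ {q r : Q8}, (∀ a, intIndicator (fibre S q) a = intIndicator (fibre S r) a) →
      fibre S q = fibre S r := by
    intro q r h
    ext a
    have := h a
    by_cases h1 : a ∈ fibre S q <;> by_cases h2 : a ∈ fibre S r <;>
      simp_all [intIndicator]
  have h1 : fibre S (.a 1) = fibre S (.a 3) := hfib (key 0)
  have h2 : fibre S (.xa 0) = fibre S (.xa 2) := hfib (key 1)
  have h3 : fibre S (.xa 1) = fibre S (.xa 3) := hfib (key 2)
  have hζ := Complex.isPrimitiveRoot_exp p (Fact.out : p.Prime).ne_zero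
  set ζ := Complex.exp (2 * Real.pi * Complex.I / p)
  have c1 : fibreCoeff S ζ (.a 1) = fibreCoeff S ζ (.a 3) := by rw [fibreCoeff, h1, fibreCoeff]
  have c2 : fibreCoeff S ζ (.xa 0) = fibreCoeff S ζ (.xa 2) := by rw [fibreCoeff, h2, fibreCoeff]
  have c3 : fibreCoeff S ζ (.xa 1) = fibreCoeff S ζ (.xa 3) := by rw [fibreCoeff, h3, fibreCoeff]
  obtain ⟨m, hm⟩ := hS.exists_int_of_sq_add hζ.pow_eq_one
    (μ := fibreCoeff S ζ (.a 0) - fibreCoeff S ζ (.a 2)) (by rw [c1, c2, c3]; ring)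
  have hs := fun {ε δ : ℂ} => hS.exists_int_of_sign hζ.pow_eq_one (ε := ε) (δ := δ)
  obtain ⟨n1, hn1⟩ := hs (one_pow 2) (one_pow 2)
  obtain ⟨n2, hn2⟩ := hs (one_pow 2) neg_one_sq
  obtain ⟨n3, hn3⟩ := hs neg_one_sq (one_pow 2)
  obtain ⟨n4, hn4⟩ := hs neg_one_sq neg_one_sq
  rw [c1, c2, c3] at hn1 hn2 hn3 hn4
  -- Character orthogonality: signed sums of the four sign values give 4 times a coefficient sum
  -- over `±q`. For `q ≠ ±1` both terms agree, hence the 8; for `±1` the difference `m` separates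
  -- them.
  have m0 : fibre S (.a 0) ∈ normalBoolAlg (Cyc p) :=
    fibre_mem_normalBoolAlg_of_fibreCoeff_eq_rat hζ (r := (n1 + n2 + n3 + n4 + 4 * m) / 8) (by
      push_cast; linear_combination (hn1 + hn2 + hn3 + hn4 + 4 * hm) / 8)
  have m2 : fibre S (.a 2) ∈ normalBoolAlg (Cyc p) :=
    fibre_mem_normalBoolAlg_of_fibreCoeff_eq_rat hζ (r := (n1 + n2 + n3 + n4 - 4 * m) / 8) (by
      push_cast; linear_combination (hn1 + hn2 + hn3 + hn4 - 4 * hm) / 8)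
  have m3 : fibre S (.a 3) ∈ normalBoolAlg (Cyc p) :=
    fibre_mem_normalBoolAlg_of_fibreCoeff_eq_rat hζ (r := (n1 + n2 - n3 - n4) / 8) (by
      push_cast; linear_combination (hn1 + hn2 - hn3 - hn4) / 8)
  have m6 : fibre S (.xa 2) ∈ normalBoolAlg (Cyc p) :=
    fibre_mem_normalBoolAlg_of_fibreCoeff_eq_rat hζ (r := (n1 - n2 + n3 - n4) / 8) (by
      push_cast; linear_combination (hn1 - hn2 + hn3 - hn4) / 8)
  have m7 : fibre S (.xa 3) ∈ normalBoolAlg (Cyc p) :=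
    fibre_mem_normalBoolAlg_of_fibreCoeff_eq_rat hζ (r := (n1 - n2 - n3 + n4) / 8) (by
      push_cast; linear_combination (hn1 - hn2 - hn3 + hn4) / 8)
  have cases8 : ∀ q : Q8, q = .a 0 ∨ q = .a 1 ∨ q = .a 2 ∨ q = .a 3 ∨ q = .xa 0 ∨ q = .xa 1 ∨
      q = .xa 2 ∨ q = .xa 3 := by decide
  constructor
  · intro q hq1 hq2
    rcases cases8 q with rfl | rfl | rfl | rfl | rfl | rfl | rfl | rfl
    · exact absurd rfl hq1
    · exact h1
    · exact absurd rfl hq2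
    · exact h1.symm
    · exact h2
    · exact h3
    · exact h2.symm
    · exact h3.symm
  · intro q
    rcases cases8 q with rfl | rfl | rfl | rfl | rfl | rfl | rfl | rfl
    · exact m0
    · rwa [h1]
    · exact m2
    · exact m3
    · rwa [h2]
    · rwa [h3]
    · exact m6
    · exact m7

end Fourier

theorem mainTheorem4 (p : ℕ) [Fact p.Prime] (hp3 : p ≠ 3)
    (S : Set (Q8 × Cyc p)) (hS : ∀ g ∈ S, g⁻¹ ∈ S) :
    (CayleyIntegral S ↔
      (fibre S 1 ∈ normalBoolAlg (Cyc p) ∧ fibre S Q8.negOne ∈ normalBoolAlg (Cyc p)) ∧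
      ∀ q : Q8, q ≠ 1 → q ≠ Q8.negOne →
        fibre S q = fibre S (Q8.negOne * q) ∧ fibre S q ∈ normalBoolAlg (Cyc p)) ∧
    (CayleyIntegral S ↔ S ∈ normalBoolAlg (Q8 × Cyc p)) := by
  have h1 : CayleyIntegral S →
      (fibre S 1 ∈ normalBoolAlg (Cyc p) ∧ fibre S Q8.negOne ∈ normalBoolAlg (Cyc p)) ∧
      ∀ q : Q8, q ≠ 1 → q ≠ Q8.negOne →
        fibre S q = fibre S (Q8.negOne * q) ∧ fibre S q ∈ normalBoolAlg (Cyc p) := fun h =>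
    have ⟨h2, h3⟩ := h.fibre_eq_and_mem hp3 hS
    ⟨⟨h3 _, h3 _⟩, fun q hq1 hq2 => ⟨h2 q hq1 hq2, h3 q⟩⟩
  have h2 := fun h : (fibre S 1 ∈ normalBoolAlg (Cyc p) ∧
      fibre S Q8.negOne ∈ normalBoolAlg (Cyc p)) ∧
      ∀ q : Q8, q ≠ 1 → q ≠ Q8.negOne →
        fibre S q = fibre S (Q8.negOne * q) ∧ fibre S q ∈ normalBoolAlg (Cyc p) =>
    mem_normalBoolAlg_of_fibre h.1.1 h.1.2 h.2
  have h3 : S ∈ normalBoolAlg (Q8 × Cyc p) → CayleyIntegral S :=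
    cayleyIntegral_of_mem_normalBoolAlg
  exact ⟨⟨h1, fun h => h3 (h2 h)⟩, ⟨fun h => h2 (h1 h), h3⟩⟩
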